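/- Let $V$ be the finite-dimensional real vector space of real trigonometric polynomials $$f(u,v)=\sum_{-2\le n,m\le 2} f_{n,m}\,e^{i(nu+mv)},\qquad f_{n,m}\in\mathbb C,\quad f_{n,m}=\overline{f_{-n,-m}},$$ with $f_{2,2}=f_{2,-2}=f_{-2,2}=f_{-2,-2}=0$. Call $f\in V$ generic if $0$ is a regular value of each of the two functions $f_{uuu}+f_u$ and $f_{vvv}+f_v$ (at every zero of the function, its gradient is non-zero), so that the two curves $f_{uuu}+f_u=0$ and $f_{vvv}+f_v=0$ on the torus are smooth and embedded. Then the generic $f$ form an open dense subset of $V$, and for every generic $f\in V$ the system $$f_{uuu}+f_u=0,\qquad f_{vvv}+f_v=0$$ has at least $12$ distinct solutions $(u,v)$ on the torus $[0,2\pi)\times[0,2\pi)$. -/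

import Mathlib

noncomputable section

/-- The real vector space of coefficient families `c = (f_{n,m})` of the real trigonometric
polynomials of bidegree at most `(2,2)` with
`f_{2,2} = f_{2,-2} = f_{-2,2} = f_{-2,-2} = 0`.
It is finite dimensional; its topology is the one induced by the product topology,
i.e. its usual vector space topology. -/
def coeffSpace : Submodule ℝ (ℤ × ℤ → ℂ) where
  carrier := {c |
    (∀ n m : ℤ, c (n, m) = (starRingEnd ℂ) (c (-n, -m))) ∧
    (∀ n m : ℤ, 2 < |n| ∨ 2 < |m| → c (n, m) = 0) ∧
    c (2, 2) = 0 ∧ c (2, -2) = 0 ∧ c (-2, 2) = 0 ∧ c (-2, -2) = 0}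
  zero_mem' := by simp
  add_mem' := by
    rintro a b ⟨ha, ha', ha1, ha2, ha3, ha4⟩ ⟨hb, hb', hb1, hb2, hb3, hb4⟩
    refine ⟨fun n m => ?_, fun n m h => ?_, ?_, ?_, ?_, ?_⟩
    · simp only [Pi.add_apply, map_add, ← ha n m, ← hb n m]
    · simp [ha' n m h, hb' n m h]
    all_goals simp only [Pi.add_apply, ha1, ha2, ha3, ha4, hb1, hb2, hb3, hb4, add_zero]
  smul_mem' := by
    rintro r a ⟨ha, ha', ha1, ha2, ha3, ha4⟩
    refine ⟨fun n m => ?_, fun n m h => ?_, ?_, ?_, ?_, ?_⟩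
    · simp only [Pi.smul_apply, Complex.real_smul, map_mul, Complex.conj_ofReal, ← ha n m]
    · simp [ha' n m h]
    all_goals simp only [Pi.smul_apply, ha1, ha2, ha3, ha4, smul_zero]

/-- `∑_{-2 ≤ n, m ≤ 2} c_{n,m} e^{i(nu+mv)}`, as a complex number. -/
def trigSum (c : ℤ × ℤ → ℂ) (u v : ℝ) : ℂ :=
  ∑ n ∈ Finset.Icc (-2 : ℤ) 2, ∑ m ∈ Finset.Icc (-2 : ℤ) 2,
    c (n, m) * Complex.exp (Complex.I * (n * u + m * v))

/-- The real function `f(u,v) = ∑_{-2 ≤ n, m ≤ 2} c_{n,m} e^{i(nu+mv)}`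
(the sum is real for `c ∈ coeffSpace`, see `ofReal_trigPoly`). -/
def trigPoly (c : ℤ × ℤ → ℂ) (u v : ℝ) : ℝ := (trigSum c u v).re

theorem ofReal_trigPoly (c : ℤ × ℤ → ℂ) (hc : c ∈ coeffSpace) (u v : ℝ) :
    (trigPoly c u v : ℂ) = trigSum c u v := by
  refine Complex.conj_eq_iff_re.mp ?_
  unfold trigSum
  rw [map_sum]
  refine Finset.sum_equiv (Equiv.neg ℤ) (fun n => ?_) (fun n _ => ?_)
  · simp only [Finset.mem_Icc, Equiv.neg_apply]; omega
  rw [map_sum]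
  refine Finset.sum_equiv (Equiv.neg ℤ) (fun m => ?_) (fun m _ => ?_)
  · simp only [Finset.mem_Icc, Equiv.neg_apply]; omega
  rw [map_mul, ← Complex.exp_conj]
  have h := hc.1 (-n) (-m)
  rw [neg_neg, neg_neg] at h
  simp only [Equiv.neg_apply, h]
  congr 2
  simp
  ring

/-- `f_{uuu} + f_u`. -/
def opU (f : ℝ → ℝ → ℝ) (u v : ℝ) : ℝ :=
  iteratedDeriv 3 (fun s => f s v) u + deriv (fun s => f s v) u

/-- `f_{vvv} + f_v`. -/
def opV (f : ℝ → ℝ → ℝ) (u v : ℝ) : ℝ :=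
  iteratedDeriv 3 (fun t => f u t) v + deriv (fun t => f u t) v

/-- `0` is a regular value of `F`: at every zero of `F` some partial derivative is non-zero
(used for smooth `F`), so that `F = 0` is a smooth embedded curve. -/
def ZeroIsRegularValue (F : ℝ → ℝ → ℝ) : Prop :=
  ∀ u v : ℝ, F u v = 0 → deriv (fun s => F s v) u ≠ 0 ∨ deriv (fun t => F u t) v ≠ 0

/-- Non-degeneracy of `f`: both curves `f_{uuu} + f_u = 0` and `f_{vvv} + f_v = 0` on the
torus are smooth embedded curves, cut out regularly. -/
def IsGenericFun (f : ℝ → ℝ → ℝ) : Prop :=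
  ZeroIsRegularValue (opU f) ∧ ZeroIsRegularValue (opV f)

/-- The points of the torus `[0,2π) × [0,2π)` at which
`f_{uuu} + f_u = 0` and `f_{vvv} + f_v = 0`. -/
def solutionSet (f : ℝ → ℝ → ℝ) : Set (ℝ × ℝ) :=
  {p | p.1 ∈ Set.Ico 0 (2 * Real.pi) ∧ p.2 ∈ Set.Ico 0 (2 * Real.pi) ∧
    opU f p.1 p.2 = 0 ∧ opV f p.1 p.2 = 0}

end

/-!
The operator `∂³ + ∂` kills the modes `n = 0, ±1`, so `f_{uuu} + f_u = 12 Im (e^{2iu} P(v))` with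
`P(v) = f_{2,-1} e^{-iv} + f_{2,0} + f_{2,1} e^{iv}` (`opU_trigPoly`), and symmetrically
`f_{vvv} + f_v = 12 Im (e^{2iv} Q(u))`; the coefficients of `P` and `Q` are independent.

Zero is a regular value of the first function exactly if `P` has no zero
(`zeroIsRegularValue_opU_iff`). This condition is open because the circle is compact, and dense
because a shift of `f_{2,0}` moves the curve `P`, whose range has dense complement, off the origin.

For generic `f`, `P` and `Q` have continuous arguments `w v + φ(v)` and `w' u + ψ(u)` with `φ`, `ψ`
periodic. Here `w, w' ∈ {-1, 0, 1}`, since `e^{iv} P(v)` is a quadratic polynomial in `e^{iv}`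
(`exists_arg_leadCoeffU`). The solutions in the universal cover are the points with
`2u + w v + φ(v) = k π` and `2v + w' u + ψ(u) = j π` for some integers `k, j`. Every label `(k, j)`
is attained (`exists_angle_solution`), and translating a point by `2π (p, q)` adds
`(4p + 2wq, 2w'p + 4q)` to its label. Hence points whose labels are incongruent modulo this lattice
are distinct on the torus. The index of the lattice is `16 - 4 w w' ≥ 12`; as all lattice vectors
are even, twelve classes come from the four parities of `(k, j)` and three classes modulo half of
the lattice (`exists_three_classes`). This count needs no transversality of the two curves.
-/

noncomputable section

/-! ### The two equations in terms of Fourier coefficients -/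

/-- The effect of `∂/∂u` on the coefficients of a trigonometric polynomial. -/
def derivCoeff (c : ℤ × ℤ → ℂ) : ℤ × ℤ → ℂ := fun p => Complex.I * p.1 * c p

theorem hasDerivAt_trigPoly (c : ℤ × ℤ → ℂ) (u v : ℝ) :
    HasDerivAt (fun s => trigPoly c s v) (trigPoly (derivCoeff c) u v) u := by
  have key : HasDerivAt (fun s : ℝ => trigSum c s v) (trigSum (derivCoeff c) u v) u := by
    simp only [trigSum]
    refine HasDerivAt.fun_sum fun n _ => HasDerivAt.fun_sum fun m _ => ?_
    have h1 : HasDerivAt (fun s : ℝ => Complex.I * ((n : ℂ) * (s : ℂ) + m * v))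
        (Complex.I * n) u := by
      simpa using
        ((((hasDerivAt_id u).ofReal_comp).const_mul (n : ℂ)).add_const (m * v : ℂ)).const_mul
          Complex.I
    refine ((h1.cexp).const_mul (c (n, m))).congr_deriv ?_
    simp only [derivCoeff]
    ring
  exact (Complex.reCLM.hasFDerivAt.comp_hasDerivAt u key)

theorem deriv_trigPoly (c : ℤ × ℤ → ℂ) (v : ℝ) :
    deriv (fun s => trigPoly c s v) = fun s => trigPoly (derivCoeff c) s v :=
  funext fun u => (hasDerivAt_trigPoly c u v).deriv

/-- The coefficients `f_{2,-1}, f_{2,0}, f_{2,1}` of `e^{2iu}`, as a trigonometric polynomial of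
degree one in `v`. -/
def leadCoeffU (c : ℤ × ℤ → ℂ) (v : ℝ) : ℂ :=
  c (2, -1) * Complex.exp (-(v * Complex.I)) + c (2, 0) + c (2, 1) * Complex.exp (v * Complex.I)

/-- The mode `e^{inu}` is multiplied by `i (n - n³)`, which is `-6i` for `n = 2`; the modes `n = ± 2`
are conjugate to each other. -/
theorem opU_trigPoly {c : ℤ × ℤ → ℂ} (hc : c ∈ coeffSpace) (u v : ℝ) :
    opU (trigPoly c) u v = 12 * (Complex.exp (2 * u * Complex.I) * leadCoeffU c v).im := by
  have h3 : iteratedDeriv 3 (fun s => trigPoly c s v) =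
      fun s => trigPoly (derivCoeff (derivCoeff (derivCoeff c))) s v := by
    simp only [iteratedDeriv_succ, iteratedDeriv_zero, deriv_trigPoly]
  -- the modes `n = 0, ±1` are killed by `∂³ + ∂`
  have hterm (n m : ℤ) : derivCoeff (derivCoeff (derivCoeff c)) (n, m) + derivCoeff c (n, m) =
      Complex.I * (n - n ^ 3) * c (n, m) := by
    simp only [derivCoeff]
    linear_combination (Complex.I * n ^ 3 * c (n, m)) * Complex.I_sq
  let T : ℤ → ℤ → ℂ := fun n m => c (n, m) * Complex.exp (Complex.I * (n * u + m * v))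
  have hconj (m : ℤ) : T (-2) m = (starRingEnd ℂ) (T 2 (-m)) := by
    simp only [T]
    rw [map_mul, ← Complex.exp_conj, hc.1 (-2) m, neg_neg]
    congr 2
    simp [map_ofNat]
    ring
  have h22 : T 2 2 = 0 := by simp [T, hc.2.2.1]
  have h22' : T 2 (-2) = 0 := by simp [T, hc.2.2.2.1]
  have hlead : Complex.exp (2 * u * Complex.I) * leadCoeffU c v = T 2 (-1) + T 2 0 + T 2 1 := by
    simp only [T, leadCoeffU, mul_add, mul_left_comm _ (c _), ← Complex.exp_add]
    simp
    ring_nf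
  have hsum : trigSum (derivCoeff (derivCoeff (derivCoeff c))) u v + trigSum (derivCoeff c) u v =
      -6 * Complex.I * (Complex.exp (2 * u * Complex.I) * leadCoeffU c v -
        (starRingEnd ℂ) (Complex.exp (2 * u * Complex.I) * leadCoeffU c v)) := by
    have : trigSum (derivCoeff (derivCoeff (derivCoeff c))) u v + trigSum (derivCoeff c) u v =
        ∑ n ∈ Finset.Icc (-2 : ℤ) 2, ∑ m ∈ Finset.Icc (-2 : ℤ) 2,
          Complex.I * (n - n ^ 3) * T n m := by
      simp only [trigSum, ← Finset.sum_add_distrib, ← add_mul, hterm, T, mul_assoc]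
    rw [this, hlead]
    clear_value T
    simp only [show Finset.Icc (-2 : ℤ) 2 = {-2, -1, 0, 1, 2} by decide]
    simp [h22, h22', hconj]
    ring
  have hre : opU (trigPoly c) u v =
      (trigSum (derivCoeff (derivCoeff (derivCoeff c))) u v + trigSum (derivCoeff c) u v).re := by
    rw [opU, h3, deriv_trigPoly, Complex.add_re]; rfl
  rw [hre, hsum]
  generalize Complex.exp (2 * u * Complex.I) * leadCoeffU c v = z
  simp
  ring

/-! ### Exchange of variables and regularity -/

/-- The coefficients of the trigonometric polynomial with the two variables exchanged. -/
def swapCoeff (c : ℤ × ℤ → ℂ) : ℤ × ℤ → ℂ := fun p => c p.swap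

theorem swapCoeff_mem {c : ℤ × ℤ → ℂ} (hc : c ∈ coeffSpace) : swapCoeff c ∈ coeffSpace :=
  ⟨fun n m => hc.1 m n, fun n m h => hc.2.1 m n h.symm, hc.2.2.1, hc.2.2.2.2.1, hc.2.2.2.1,
    hc.2.2.2.2.2⟩

theorem trigPoly_swapCoeff (c : ℤ × ℤ → ℂ) (u v : ℝ) :
    trigPoly (swapCoeff c) u v = trigPoly c v u := by
  simp only [trigPoly, trigSum, swapCoeff, Prod.swap_prod_mk]
  rw [Finset.sum_comm]
  simp only [add_comm]

theorem opV_trigPoly_eq_opU (c : ℤ × ℤ → ℂ) (u v : ℝ) :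
    opV (trigPoly c) u v = opU (trigPoly (swapCoeff c)) v u := by
  simp only [opV, opU, trigPoly_swapCoeff]

theorem differentiableAt_leadCoeffU (c : ℤ × ℤ → ℂ) (v : ℝ) : DifferentiableAt ℝ (leadCoeffU c) v := by
  have h1 : DifferentiableAt ℝ (fun v : ℝ => (v : ℂ) * Complex.I) v :=
    (Complex.ofRealCLM.differentiableAt).mul_const _
  exact ((h1.neg.cexp.const_mul _).add_const _).add (h1.cexp.const_mul _)

/-- Zero is a regular value of `f_{uuu} + f_u = 12 Im (e^{2iu} P(v))` exactly if `P` has no zero: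
where `P ≠ 0`, the function and its `u`-derivative do not vanish together, while at a zero of `P`
the gradient vanishes for `u = - arg P' / 2`. -/
theorem zeroIsRegularValue_opU_iff {c : ℤ × ℤ → ℂ} (hc : c ∈ coeffSpace) :
    ZeroIsRegularValue (opU (trigPoly c)) ↔ ∀ v, leadCoeffU c v ≠ 0 := by
  have hderivU (u v : ℝ) : HasDerivAt (fun s => opU (trigPoly c) s v)
      (24 * (Complex.exp (2 * u * Complex.I) * leadCoeffU c v).re) u := by
    simp only [opU_trigPoly hc]
    have h1 : HasDerivAt (fun s : ℝ => 2 * (s : ℂ) * Complex.I) (2 * Complex.I) u := by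
      simpa using (((hasDerivAt_id u).ofReal_comp).const_mul (2 : ℂ)).mul_const Complex.I
    refine ((Complex.imCLM.hasFDerivAt.comp_hasDerivAt u
      (h1.cexp.mul_const (leadCoeffU c v))).const_mul 12).congr_deriv ?_
    rw [Complex.imCLM_apply, show ∀ a b : ℂ, a * (2 * Complex.I) * b = 2 * Complex.I * (a * b) by
      intros; ring]
    simp
    ring
  have hderivV (u v : ℝ) : HasDerivAt (fun t => opU (trigPoly c) u t)
      (12 * (Complex.exp (2 * u * Complex.I) * deriv (leadCoeffU c) v).im) v := by
    simp only [opU_trigPoly hc]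
    exact (Complex.imCLM.hasFDerivAt.comp_hasDerivAt v
      ((differentiableAt_leadCoeffU c v).hasDerivAt.const_mul _)).const_mul 12
  constructor
  · intro h v hv
    set d := deriv (leadCoeffU c) v with hd
    obtain ⟨u, hu⟩ : ∃ u : ℝ, (Complex.exp (2 * u * Complex.I) * d).im = 0 := by
      refine ⟨-(Complex.arg d) / 2, ?_⟩
      have : Complex.exp (2 * ((-(Complex.arg d) / 2 : ℝ) : ℂ) * Complex.I) *
          (‖d‖ * Complex.exp (Complex.arg d * Complex.I)) = ‖d‖ := by
        rw [mul_left_comm, ← Complex.exp_add]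
        push_cast
        ring_nf
        simp
      rw [Complex.norm_mul_exp_arg_mul_I d] at this
      rw [this, Complex.ofReal_im]
    rcases h u v (by simp [opU_trigPoly hc, hv]) with h | h
    · exact h (by simp [(hderivU u v).deriv, hv])
    · exact h (by rw [(hderivV u v).deriv, ← hd, hu, mul_zero])
  · intro h u v h0
    left
    rw [(hderivU u v).deriv]
    intro h1
    rw [opU_trigPoly hc] at h0
    have : Complex.exp (2 * u * Complex.I) * leadCoeffU c v = 0 :=
      Complex.ext (by simpa using h1) (by simpa using h0)
    exact (mul_ne_zero (Complex.exp_ne_zero _) (h v)) this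

theorem isGenericFun_trigPoly_iff {c : ℤ × ℤ → ℂ} (hc : c ∈ coeffSpace) :
    IsGenericFun (trigPoly c) ↔
      (∀ v, leadCoeffU c v ≠ 0) ∧ ∀ u, leadCoeffU (swapCoeff c) u ≠ 0 := by
  rw [IsGenericFun, zeroIsRegularValue_opU_iff hc,
    ← zeroIsRegularValue_opU_iff (swapCoeff_mem hc)]
  refine and_congr_right fun _ => ?_
  simp only [ZeroIsRegularValue, opV_trigPoly_eq_opU]
  exact ⟨fun h u v h0 => (h v u h0).symm, fun h u v h0 => (h v u h0).symm⟩

/-! ### Openness and density of the generic polynomials -/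

theorem leadCoeffU_periodic (c : ℤ × ℤ → ℂ) : Function.Periodic (leadCoeffU c) (2 * Real.pi) := by
  intro v
  simp only [leadCoeffU, Complex.ofReal_add, add_mul, neg_add, Complex.exp_add, Complex.exp_neg]
  simp [Complex.exp_two_pi_mul_I]

/-- Non-vanishing of the leading coefficient is an open condition: by periodicity `v` may be
restricted to the compact interval `[0, 2π]`. -/
theorem isOpen_forall_leadCoeffU_ne_zero :
    IsOpen {c : ℤ × ℤ → ℂ | ∀ v, leadCoeffU c v ≠ 0} := by
  have hcont : Continuous fun q : (ℤ × ℤ → ℂ) × Set.Icc 0 (2 * Real.pi) =>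
      leadCoeffU q.1 (q.2 : ℝ) := by
    unfold leadCoeffU
    fun_prop
  have hclosed := isClosedMap_fst_of_compactSpace _
    ((isClosed_singleton (x := (0 : ℂ))).preimage hcont)
  convert hclosed.isOpen_compl using 1
  ext c
  simp only [Set.mem_ofPred_eq, Set.mem_compl_iff, Set.mem_image, Set.mem_preimage,
    Set.mem_singleton_iff, Prod.exists, exists_and_right, exists_eq_right, not_exists]
  refine ⟨fun h v => h v, fun h v hv => ?_⟩
  obtain ⟨y, hy, hvy⟩ := (leadCoeffU_periodic c).exists_mem_Ico₀ Real.two_pi_pos v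
  exact h ⟨y, hy.1, hy.2.le⟩ (by rw [← hvy, hv])

/-- The coefficients of `2 Re (δ e^{2iu}) + 2 Re (ε e^{2iv})`. -/
def pureModes (q : ℂ × ℂ) : ℤ × ℤ → ℂ := fun p =>
  if p = (2, 0) then q.1 else if p = (-2, 0) then (starRingEnd ℂ) q.1 else
  if p = (0, 2) then q.2 else if p = (0, -2) then (starRingEnd ℂ) q.2 else 0

theorem pureModes_mem (q : ℂ × ℂ) : pureModes q ∈ coeffSpace := by
  refine ⟨fun n m => ?_, fun n m h => ?_, ?_⟩
  · simp only [pureModes, Prod.mk.injEq]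
    split_ifs <;> first | omega | simp
  · simp only [pureModes, Prod.mk.injEq]
    split_ifs with h1 h2 h3 h4 <;> first | rfl | (exfalso; simp_all)
  · simp [pureModes]

theorem continuous_pureModes : Continuous pureModes := by
  refine continuous_pi fun p => ?_
  simp only [pureModes]
  split_ifs <;> fun_prop

theorem leadCoeffU_add_pureModes (c : ℤ × ℤ → ℂ) (q : ℂ × ℂ) (v : ℝ) :
    leadCoeffU (c + pureModes q) v = leadCoeffU c v + q.1 := by
  simp [leadCoeffU, pureModes]
  ring

theorem leadCoeffU_swapCoeff_add_pureModes (c : ℤ × ℤ → ℂ) (q : ℂ × ℂ) (u : ℝ) :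
    leadCoeffU (swapCoeff (c + pureModes q)) u = leadCoeffU (swapCoeff c) u + q.2 := by
  simp [leadCoeffU, swapCoeff, pureModes]
  ring

/-- The range of a smooth curve in the plane has dense complement, so almost all shifts of the
leading coefficient have no zero. -/
theorem dense_shift_leadCoeffU_ne_zero (c : ℤ × ℤ → ℂ) :
    Dense {δ : ℂ | ∀ v, leadCoeffU c v + δ ≠ 0} := by
  have hsmooth : ContDiff ℝ 1 (fun v => -leadCoeffU c v) := by
    unfold leadCoeffU
    have : ContDiff ℝ 1 (fun v : ℝ => (v : ℂ)) := Complex.ofRealCLM.contDiff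
    fun_prop
  convert hsmooth.dense_compl_range_of_finrank_lt_finrank
    (by rw [Complex.finrank_real_complex]; simp) using 1
  ext δ
  simp [neg_eq_iff_add_eq_zero]

theorem isOpen_isGenericFun :
    IsOpen {c : coeffSpace | IsGenericFun (trigPoly (c : ℤ × ℤ → ℂ))} := by
  have : {c : coeffSpace | IsGenericFun (trigPoly (c : ℤ × ℤ → ℂ))} =
      (fun c : coeffSpace => (c : ℤ × ℤ → ℂ)) ⁻¹' {c | ∀ v, leadCoeffU c v ≠ 0} ∩
      (fun c : coeffSpace => swapCoeff (c : ℤ × ℤ → ℂ)) ⁻¹' {c | ∀ v, leadCoeffU c v ≠ 0} := by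
    ext c
    exact isGenericFun_trigPoly_iff c.2
  rw [this]
  refine (isOpen_forall_leadCoeffU_ne_zero.preimage continuous_subtype_val).inter
    (isOpen_forall_leadCoeffU_ne_zero.preimage ?_)
  exact continuous_pi fun p => (continuous_apply p.swap).comp continuous_subtype_val

theorem dense_isGenericFun :
    Dense {c : coeffSpace | IsGenericFun (trigPoly (c : ℤ × ℤ → ℂ))} := by
  intro c
  let shift : ℂ × ℂ → coeffSpace := fun q => c + ⟨pureModes q, pureModes_mem q⟩
  have hshift : Continuous shift :=
    continuous_const.add (continuous_pureModes.subtype_mk _)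
  have hc : shift 0 = c := by
    refine Subtype.ext (funext fun p => ?_)
    simp [shift, pureModes]
  have hmem := mem_closure_image hshift.continuousAt
    (((dense_shift_leadCoeffU_ne_zero c).prod (dense_shift_leadCoeffU_ne_zero (swapCoeff c))) 0)
  rw [hc] at hmem
  refine closure_mono ?_ hmem
  rintro _ ⟨q, hq, rfl⟩
  refine (isGenericFun_trigPoly_iff (shift q).2).2 ⟨fun v => ?_, fun u => ?_⟩
  · have : ((shift q : coeffSpace) : ℤ × ℤ → ℂ) = c + pureModes q := rfl
    rw [this, leadCoeffU_add_pureModes]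
    exact hq.1 v
  · have : ((shift q : coeffSpace) : ℤ × ℤ → ℂ) = c + pureModes q := rfl
    rw [this, leadCoeffU_swapCoeff_add_pureModes]
    exact hq.2 u

/-! ### Arguments and winding numbers -/

/-- A linear polynomial `z - r` without zero on the unit circle has there a continuous argument
`n v + φ v`, with winding number `n ∈ {0, 1}` and `φ` periodic. -/
theorem exists_arg_sub_of_forall_ne_zero {r : ℂ}
    (hr : ∀ v : ℝ, Complex.exp (v * Complex.I) - r ≠ 0) :
    ∃ n ≤ 1, ∃ φ : ℝ → ℝ, Continuous φ ∧ Function.Periodic φ (2 * Real.pi) ∧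
      ∀ v : ℝ, Complex.exp (v * Complex.I) - r =
        ‖Complex.exp (v * Complex.I) - r‖ * Complex.exp (((n : ℕ) * v + φ v : ℝ) * Complex.I) := by
  have hexp_per (v : ℝ) : Complex.exp ((v + 2 * Real.pi : ℝ) * Complex.I) =
      Complex.exp (v * Complex.I) := by
    push_cast
    rw [add_mul, Complex.exp_periodic]
  rcases lt_trichotomy ‖r‖ 1 with h | h | h
  · -- `z - r = z (1 - r / z)`, and `1 - r / z` stays in the right half plane
    have hcont : Continuous fun v : ℝ => 1 + -r / Complex.exp (v * Complex.I) := by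
      refine continuous_const.add (continuous_const.div (by fun_prop) fun v => Complex.exp_ne_zero _)
    refine ⟨1, le_rfl, fun v => Complex.arg (1 + -r / Complex.exp (v * Complex.I)), ?_, ?_, ?_⟩
    · refine continuous_iff_continuousAt.2 fun v => ?_
      refine (Complex.continuousAt_arg ?_).comp (f := fun v : ℝ =>
        1 + -r / Complex.exp (v * Complex.I)) hcont.continuousAt
      refine Complex.mem_slitPlane_of_norm_lt_one ?_
      rwa [norm_div, Complex.norm_exp_ofReal_mul_I, div_one, norm_neg]
    · intro v
      simp only [hexp_per]
    · intro v
      have hfac : Complex.exp (v * Complex.I) - r =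
          Complex.exp (v * Complex.I) * (1 + -r / Complex.exp (v * Complex.I)) := by
        field_simp [Complex.exp_ne_zero]
        ring
      rw [hfac, norm_mul, Complex.norm_exp_ofReal_mul_I, one_mul]
      push_cast
      rw [one_mul, add_mul, Complex.exp_add, mul_left_comm, Complex.norm_mul_exp_arg_mul_I]
  · refine absurd ?_ (hr (Complex.arg r))
    have := Complex.norm_mul_exp_arg_mul_I r
    rw [h, Complex.ofReal_one, one_mul] at this
    rw [this, sub_self]
  · -- `z - r = -r (1 - z / r)`, and `1 - z / r` stays in the right half plane
    have hr0 : r ≠ 0 := by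
      rintro rfl
      simp at h
      linarith
    refine ⟨0, zero_le_one, fun v => Complex.arg (-r) +
      Complex.arg (1 + -Complex.exp (v * Complex.I) / r), ?_, ?_, ?_⟩
    · refine continuous_iff_continuousAt.2 fun v => continuousAt_const.add ?_
      refine (Complex.continuousAt_arg ?_).comp (f := fun v : ℝ =>
        1 + -Complex.exp (v * Complex.I) / r) (by fun_prop)
      refine Complex.mem_slitPlane_of_norm_lt_one ?_
      rw [norm_div, norm_neg, Complex.norm_exp_ofReal_mul_I]
      exact (div_lt_one (by linarith)).2 h
    · intro v
      simp only [hexp_per]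
    · intro v
      have hfac : Complex.exp (v * Complex.I) - r =
          -r * (1 + -Complex.exp (v * Complex.I) / r) := by
        field_simp
        ring
      rw [hfac, norm_mul]
      push_cast
      rw [zero_mul, zero_add, add_mul, Complex.exp_add, mul_mul_mul_comm,
        ← Complex.norm_mul_exp_arg_mul_I (-r), ← Complex.norm_mul_exp_arg_mul_I (1 + _)]
      simp only [Complex.norm_mul_exp_arg_mul_I]

/-- A weak form of the argument principle: a polynomial without zero on the unit circle has there
a continuous argument, whose winding number is a natural number at most the degree. -/
theorem Polynomial.exists_arg_of_forall_ne_zero (p : Polynomial ℂ)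
    (hp : ∀ v : ℝ, p.eval (Complex.exp (v * Complex.I)) ≠ 0) :
    ∃ n ≤ p.natDegree, ∃ φ : ℝ → ℝ, Continuous φ ∧ Function.Periodic φ (2 * Real.pi) ∧
      ∀ v : ℝ, p.eval (Complex.exp (v * Complex.I)) =
        ‖p.eval (Complex.exp (v * Complex.I))‖ *
          Complex.exp (((n : ℕ) * v + φ v : ℝ) * Complex.I) := by
  induction hd : p.natDegree generalizing p with
  | zero =>
    obtain ⟨a, rfl⟩ := Polynomial.natDegree_eq_zero.1 hd
    refine ⟨0, le_rfl, fun _ => Complex.arg a, continuous_const, fun _ => rfl, fun v => ?_⟩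
    simp [Complex.norm_mul_exp_arg_mul_I]
  | succ d ih =>
    obtain ⟨r, hr⟩ := Complex.exists_root (f := p)
      (Polynomial.natDegree_pos_iff_degree_pos.1 (by omega))
    obtain ⟨q, rfl⟩ := Polynomial.dvd_iff_isRoot.2 hr
    simp only [Polynomial.eval_mul, Polynomial.eval_sub, Polynomial.eval_X,
      Polynomial.eval_C] at hp ⊢
    have hq0 : q ≠ 0 := by
      rintro rfl
      simp at hd
    obtain ⟨n, hn, φ, hφ, hφp, hφe⟩ := ih q (fun v => right_ne_zero_of_mul (hp v)) (by
      rw [Polynomial.natDegree_mul (Polynomial.X_sub_C_ne_zero r) hq0,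
        Polynomial.natDegree_X_sub_C] at hd
      omega)
    obtain ⟨k, hk, χ, hχ, hχp, hχe⟩ :=
      exists_arg_sub_of_forall_ne_zero fun v => left_ne_zero_of_mul (hp v)
    refine ⟨k + n, by omega, fun v => χ v + φ v, hχ.add hφ, hχp.add hφp, fun v => ?_⟩
    conv_lhs => rw [hχe v, hφe v]
    rw [norm_mul, mul_mul_mul_comm, ← Complex.exp_add]
    push_cast
    ring_nf

/-- The winding number of a trigonometric polynomial of degree one without zero is `0` or `± 1`:
multiplied by `e^{iv}` it is a quadratic polynomial in `e^{iv}`. -/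
theorem exists_arg_leadCoeffU {c : ℤ × ℤ → ℂ} (hc : ∀ v, leadCoeffU c v ≠ 0) :
    ∃ w : ℤ, |w| ≤ 1 ∧ ∃ φ : ℝ → ℝ, Continuous φ ∧ Function.Periodic φ (2 * Real.pi) ∧
      ∀ v, leadCoeffU c v = ‖leadCoeffU c v‖ * Complex.exp ((w * v + φ v : ℝ) * Complex.I) := by
  let p : Polynomial ℂ := .C (c (2, 1)) * .X ^ 2 + .C (c (2, 0)) * .X + .C (c (2, -1))
  have hp (v : ℝ) : leadCoeffU c v =
      Complex.exp ((-v : ℝ) * Complex.I) * p.eval (Complex.exp (v * Complex.I)) := by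
    simp [leadCoeffU, p, Complex.exp_neg]
    field_simp [Complex.exp_ne_zero]
    ring
  obtain ⟨n, hn, φ, hφ, hφp, hφe⟩ := p.exists_arg_of_forall_ne_zero fun v h =>
    hc v (by rw [hp, h, mul_zero])
  have hn2 : n ≤ 2 := hn.trans Polynomial.natDegree_quadratic_le
  refine ⟨n - 1, by rw [abs_le]; omega, φ, hφ, hφp, fun v => ?_⟩
  rw [hp, norm_mul, Complex.norm_exp_ofReal_mul_I, one_mul]
  conv_lhs => rw [hφe v]
  rw [mul_left_comm, ← Complex.exp_add]
  push_cast
  ring_nf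

/-! ### Counting the solutions -/

/-- Two angle equations with winding numbers `w`, `w'` can be solved for every right hand side:
eliminating `u` leaves an equation in `v` whose left side is `(2 - w w' / 2) v` up to a bounded
term. -/
theorem exists_angle_solution {w w' : ℤ} (hw : |w| ≤ 1) (hw' : |w'| ≤ 1) {φ ψ : ℝ → ℝ}
    (hφ : Continuous φ) (hφp : Function.Periodic φ (2 * Real.pi))
    (hψ : Continuous ψ) (hψp : Function.Periodic ψ (2 * Real.pi)) (A B : ℝ) :
    ∃ u v : ℝ, 2 * u + (w * v + φ v) = A ∧ 2 * v + (w' * u + ψ u) = B := by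
  obtain ⟨M, hM⟩ := (hφp.isBounded_of_continuous Real.two_pi_pos.ne' hφ).exists_norm_le
  obtain ⟨N, hN⟩ := (hψp.isBounded_of_continuous Real.two_pi_pos.ne' hψ).exists_norm_le
  simp only [Set.forall_mem_range, Real.norm_eq_abs] at hM hN
  let g : ℝ → ℝ := fun v => (A - w * v - φ v) / 2
  let k : ℝ := 2 - w' * w / 2
  have hwR : |(w : ℝ)| ≤ 1 := by exact_mod_cast hw
  have hwR' : |(w' : ℝ)| ≤ 1 := by exact_mod_cast hw'
  have hk : 0 < k := by
    have : |(w' : ℝ) * w| ≤ 1 := by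
      rw [abs_mul]
      exact mul_le_one₀ hwR' (abs_nonneg _) hwR
    have := (abs_le.1 this).2
    simp only [k]
    linarith
  let h : ℝ → ℝ := fun v => k * v + (w' * (A - φ v) / 2 + ψ (g v))
  have hbound (v : ℝ) : |w' * (A - φ v) / 2 + ψ (g v)| ≤ (|A| + M) / 2 + N := by
    refine (abs_add_le _ _).trans (add_le_add ?_ (hN _))
    rw [abs_div, abs_mul, abs_two]
    gcongr
    calc |(w' : ℝ)| * |A - φ v| ≤ 1 * (|A| + M) :=
          mul_le_mul hwR' ((abs_sub _ _).trans (by gcongr; exact hM v)) (abs_nonneg _) zero_le_one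
      _ = |A| + M := one_mul _
  have hcont : Continuous h := by
    simp only [h, g]
    fun_prop
  have htop : Filter.Tendsto h Filter.atTop Filter.atTop :=
    Filter.tendsto_atTop_add_right_of_le _ (-((|A| + M) / 2 + N))
      (Filter.tendsto_id.const_mul_atTop hk) fun v => (abs_le.1 (hbound v)).1
  have hbot : Filter.Tendsto h Filter.atBot Filter.atBot :=
    Filter.tendsto_atBot_add_right_of_ge _ ((|A| + M) / 2 + N)
      (Filter.tendsto_id.const_mul_atBot hk) fun v => (abs_le.1 (hbound v)).2
  obtain ⟨v, hv⟩ := hcont.surjective htop hbot B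
  refine ⟨g v, v, by simp only [g]; ring, ?_⟩
  rw [← hv]
  simp only [h, k, g]
  ring

/-- Representatives `(x, y)` of three classes of `ℤ²` modulo the lattice spanned by `(2, w')` and
`(w, 2)`, whose index is `4 - w w' ≥ 3`. -/
theorem exists_three_classes {w w' : ℤ} (hw : |w| ≤ 1) (hw' : |w'| ≤ 1) :
    ∃ x y : Fin 3 → ℤ, ∀ i j, ∀ p q : ℤ, x i - x j = 2 * p + w * q → y i - y j = w' * p + 2 * q →
      i = j := by
  rw [abs_le] at hw hw'
  obtain ⟨hw1, hw2⟩ := hw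
  obtain ⟨hw1', hw2'⟩ := hw'
  -- `(0, 0)`, `(1, 0)`, `(0, 1)` fail only for `w = 1`: then `w' = 1` makes `(1, -1)` a lattice vector
  refine ⟨![0, 1, 0], ![0, 0, if w = 1 then -1 else 1], fun i j p q => ?_⟩
  interval_cases w <;> interval_cases w' <;> fin_cases i <;> fin_cases j <;> simp <;> omega

/-- If `P = ρ e^{iθ}`, then `Im (e^{2iu} P)` vanishes as soon as `2 u + θ` is a multiple of `π`. -/
theorem opU_trigPoly_eq_zero {c : ℤ × ℤ → ℂ} (hc : c ∈ coeffSpace) {u v θ : ℝ}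
    (hθ : leadCoeffU c v = ‖leadCoeffU c v‖ * Complex.exp (θ * Complex.I)) {k : ℤ}
    (hk : 2 * u + θ = k * Real.pi) : opU (trigPoly c) u v = 0 := by
  have : Complex.exp (2 * u * Complex.I) * leadCoeffU c v =
      (‖leadCoeffU c v‖ : ℂ) * Complex.exp ((k * Real.pi : ℝ) * Complex.I) := by
    conv_lhs => rw [hθ]
    rw [mul_left_comm, ← Complex.exp_add, ← hk]
    push_cast
    ring_nf
  rw [opU_trigPoly hc, this, Complex.im_ofReal_mul, Complex.exp_ofReal_mul_I_im,
    Real.sin_int_mul_pi, mul_zero, mul_zero]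

theorem opU_trigPoly_toIcoMod (c : coeffSpace) (u v : ℝ) :
    opU (trigPoly (c : ℤ × ℤ → ℂ)) (toIcoMod Real.two_pi_pos 0 u)
      (toIcoMod Real.two_pi_pos 0 v) = opU (trigPoly (c : ℤ × ℤ → ℂ)) u v := by
  have h1 : Function.Periodic (fun u : ℝ => Complex.exp (2 * u * Complex.I)) (2 * Real.pi) := by
    intro u
    have : 2 * ((u + 2 * Real.pi : ℝ) : ℂ) * Complex.I =
        2 * u * Complex.I + (2 : ℕ) * (2 * Real.pi * Complex.I) := by
      push_cast
      ring
    simp only [this, Complex.exp_periodic.nat_mul 2 _]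
  have e1 := h1.sub_zsmul_eq (x := u) (toIcoDiv Real.two_pi_pos 0 u)
  have e2 := (leadCoeffU_periodic c).sub_zsmul_eq (x := v) (toIcoDiv Real.two_pi_pos 0 v)
  rw [self_sub_toIcoDiv_zsmul] at e1 e2
  rw [opU_trigPoly c.2, opU_trigPoly c.2, e2]
  exact congrArg (fun z : ℂ => 12 * (z * leadCoeffU (c : ℤ × ℤ → ℂ) v).im) e1

theorem twelve_le_encard_solutionSet (c : coeffSpace)
    (hgen : IsGenericFun (trigPoly (c : ℤ × ℤ → ℂ))) :
    12 ≤ (solutionSet (trigPoly (c : ℤ × ℤ → ℂ))).encard := by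
  obtain ⟨hP, hQ⟩ := (isGenericFun_trigPoly_iff c.2).1 hgen
  obtain ⟨w, hw, φ, hφ, hφp, hφe⟩ := exists_arg_leadCoeffU hP
  obtain ⟨w', hw', ψ, hψ, hψp, hψe⟩ := exists_arg_leadCoeffU hQ
  obtain ⟨x, y, hxy⟩ := exists_three_classes hw hw'
  -- the labels `(k, j)` are pairwise incongruent modulo the lattice of `(4, 2 w')`, `(2 w, 4)`
  let k : Fin 2 × Fin 2 × Fin 3 → ℤ := fun i => i.1.val + 2 * x i.2.2
  let j : Fin 2 × Fin 2 × Fin 3 → ℤ := fun i => i.2.1.val + 2 * y i.2.2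
  choose u v hu hv using fun i => exists_angle_solution hw hw' hφ hφp hψ hψp
    (k i * Real.pi) (j i * Real.pi)
  let pt : Fin 2 × Fin 2 × Fin 3 → ℝ × ℝ := fun i =>
    (toIcoMod Real.two_pi_pos 0 (u i), toIcoMod Real.two_pi_pos 0 (v i))
  have hmem (i) : pt i ∈ solutionSet (trigPoly (c : ℤ × ℤ → ℂ)) := by
    refine ⟨toIcoMod_mem_Ico' _ _, toIcoMod_mem_Ico' _ _, ?_, ?_⟩
    · rw [opU_trigPoly_toIcoMod]
      exact opU_trigPoly_eq_zero c.2 (hφe _) (hu i)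
    · rw [opV_trigPoly_eq_opU]
      rw [opU_trigPoly_toIcoMod ⟨_, swapCoeff_mem c.2⟩]
      exact opU_trigPoly_eq_zero (swapCoeff_mem c.2) (hψe _) (hv i)
  have hinj : Function.Injective pt := by
    intro a b hab
    rw [Prod.mk.injEq, toIcoMod_eq_toIcoMod, toIcoMod_eq_toIcoMod] at hab
    obtain ⟨⟨p, hp⟩, q, hq⟩ := hab
    have hφab : φ (v b) = φ (v a) := by
      rw [sub_eq_iff_eq_add'.1 hq, hφp.zsmul q]
    have hψab : ψ (u b) = ψ (u a) := by
      rw [sub_eq_iff_eq_add'.1 hp, hψp.zsmul p]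
    rw [zsmul_eq_mul] at hp hq
    -- translating a point by `2π (p, q)` changes its labels by a lattice vector
    have hk : k b - k a = 4 * p + 2 * (w * q) := by
      have : ((k b - k a : ℤ) : ℝ) * Real.pi = (4 * p + 2 * (w * q) : ℤ) * Real.pi := by
        push_cast
        linear_combination hu a - hu b + 2 * hp + w * hq + hφab
      exact_mod_cast mul_right_cancel₀ Real.pi_ne_zero this
    have hj : j b - j a = 2 * (w' * p) + 4 * q := by
      have : ((j b - j a : ℤ) : ℝ) * Real.pi = (2 * (w' * p) + 4 * q : ℤ) * Real.pi := by
        push_cast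
        linear_combination hv a - hv b + 2 * hq + w' * hp + hψab
      exact_mod_cast mul_right_cancel₀ Real.pi_ne_zero this
    simp only [k, j] at hk hj
    have h3 : b.2.2 = a.2.2 := hxy _ _ p q (by omega) (by omega)
    exact Prod.ext (Fin.ext (by omega)) (Prod.ext (Fin.ext (by omega)) h3.symm)
  calc (12 : ℕ∞) = (Set.range pt).encard := by
        rw [← Set.image_univ, hinj.encard_image]
        simp
    _ ≤ _ := Set.encard_le_encard (Set.range_subset_iff.2 hmem)

end

theorem mainTheorem4 :
    IsOpen {c : coeffSpace | IsGenericFun (trigPoly (c : ℤ × ℤ → ℂ))} ∧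
    Dense {c : coeffSpace | IsGenericFun (trigPoly (c : ℤ × ℤ → ℂ))} ∧
    ∀ c : coeffSpace, IsGenericFun (trigPoly (c : ℤ × ℤ → ℂ)) →
      12 ≤ (solutionSet (trigPoly (c : ℤ × ℤ → ℂ))).encard :=
  ⟨isOpen_isGenericFun, dense_isGenericFun, twelve_le_encard_solutionSet⟩
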